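/- Let $I$ be a finite non-empty index set. A random vector $X=(X_i)_{i\in I}$ on a probability space $(\Omega,\mathcal A,\mathbb P)$ is called max-stable if for every $n\ge 1$ there are normalizing constants $a_n\in(0,\infty)^I$, $b_n\in\mathbb R^I$ such that $a_nX+b_n$ has the same distribution as $\max(X^{(1)},\dots,X^{(n)})$ for independent copies $X^{(1)},\dots,X^{(n)}$ of $X$ (all operations componentwise); it is called simple max-stable if moreover $\mathbb P(X_i\le x)=\exp(-1/x)$ for all $i\in I$ and $x\in(0,\infty)$. For $A\subset I$ write $X_A=(X_i)_{i\in A}$. Random variables $Y_1,\dots,Y_k$ are conditionally independent given $Z$ if $\mathbb P(Y_1\in S_1,\dots,Y_k\in S_k\mid Z)=\prod_{i=1}^k\mathbb P(Y_i\in S_i\mid Z)$ almost surely for all measurable sets $S_1,\dots,S_k$. Let $X=(X_i)_{i\in I}$ be a simple max-stable random vector whose joint distribution has a density (with respect to Lebesgue measure) that is positive and continuous on $(0,\infty)^I$. Let $A_1,\dots,A_k$ be pairwise disjoint non-empty subsets of $I$. If $X_{A_1},\dots,X_{A_k}$ are conditionally independent given $X_{I\setminus\bigcup_{i=1}^kA_i}$,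 then $X_{A_1},\dots,X_{A_k}$ are (jointly) independent. -/

import Mathlib

open MeasureTheory ProbabilityTheory

noncomputable section

namespace MaxStable

/-- The subvector `X_A = (X_i)_{i ∈ A}` of a random vector `X = (X_i)_{i ∈ I}`. -/
def subvector {Ω I : Type*} (X : Ω → I → ℝ) (A : Set I) : Ω → A → ℝ :=
  fun ω j => X ω j

/-- `Y 1, …, Y k` are conditionally independent given (the σ-algebra generated by) `Z`:
almost surely `P(Y 1 ∈ s 1, …, Y k ∈ s k | Z) = ∏ i, P(Y i ∈ s i | Z)`
for all measurable sets `s 1, …, s k`. -/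
def CondIndepGiven {Ω ι γ : Type*} {β : ι → Type*} [Fintype ι] [MeasurableSpace Ω]
    [∀ i, MeasurableSpace (β i)] [MeasurableSpace γ]
    (Y : ∀ i, Ω → β i) (Z : Ω → γ) (μ : Measure Ω) : Prop :=
  ∀ s : ∀ i, Set (β i), (∀ i, MeasurableSet (s i)) →
    μ⟦⋂ i, Y i ⁻¹' s i | MeasurableSpace.comap Z inferInstance⟧ =ᵐ[μ]
      fun ω => ∏ i, (μ⟦Y i ⁻¹' s i | MeasurableSpace.comap Z inferInstance⟧) ω

/-- Max-stability of a random vector `X`: for every `n ≥ 1` there are componentwise normalizing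
constants `a > 0` and `b` such that `a X + b` has the law of the componentwise maximum of `n`
independent copies of `X`, realized as the coordinates of the `n`-fold product of the law of `X`. -/
def IsMaxStable {Ω I : Type*} [MeasurableSpace Ω] (X : Ω → I → ℝ) (μ : Measure Ω) : Prop :=
  ∀ n : ℕ, 1 ≤ n → ∃ a b : I → ℝ, (∀ i, 0 < a i) ∧
    μ.map (fun ω i => a i * X ω i + b i) =
      (Measure.pi fun _ : Fin n => μ.map X).map (fun y i => ⨆ j : Fin n, y j i)

/-- A max-stable random vector whose components are standard Fréchet distributed. -/
structure IsSimpleMaxStable {Ω I : Type*} [MeasurableSpace Ω] (X : Ω → I → ℝ)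
    (μ : Measure Ω) : Prop where
  isMaxStable : IsMaxStable X μ
  frechet : ∀ i : I, ∀ x : ℝ, 0 < x → μ.real {ω | X ω i ≤ x} = Real.exp (-(1 / x))

/-- The open orthant `(0, ∞)^I`. -/
def orthant (I : Type*) : Set (I → ℝ) := {x | ∀ i, 0 < x i}

/-- The law of `X` has a positive continuous density on `(0, ∞)^I` (and no mass elsewhere). -/
def HasPositiveContinuousDensity {Ω I : Type*} [Fintype I] [MeasurableSpace Ω]
    (X : Ω → I → ℝ) (μ : Measure Ω) : Prop :=
  ∃ f : (I → ℝ) → ℝ, ContinuousOn f (orthant I) ∧ (∀ x ∈ orthant I, 0 < f x) ∧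
    μ.map X = (volume.restrict (orthant I)).withDensity (fun x => ENNReal.ofReal (f x))

end MaxStable

end

/-!
Write `F_S` for the distribution function of the subvector `X_S`. Max-stability together with the
Fréchet margins says `F_S (x / n) = F_S x ^ n` for all `n ≥ 1` (`subCdf_div_natCast`).

Let `C` be the complement of `⋃ i, A i`, put `m = |C|`, and let `S` be disjoint from `C`. Fix a
vector `x` in the orthant. The density of `X_C` on the event `X_S ≤ x_S / n`, evaluated at
`x_C / n`, is for almost every `x_C` a limit of probabilities of shrinking boxes. By
inclusion-exclusion such a probability is an alternating sum of `n`-th powers of values of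
`F_{S ∪ C}` near `x`. These values are `F_{S ∪ C} x * (1 + O(r))` for boxes of radius `r`, so after
binomial expansion only terms of order at most `m` survive division by `(2 r) ^ m`: the density
equals `F_{S ∪ C} x ^ n` times a polynomial in `n` (`exists_polynomial_eventDensity`). The exponent
function `-log F` never has to be differentiated.

Conditional independence given `X_C` is a multiplicative identity between these densities for
`S = ⋃ i, A i`, `S = A i` and `S = ∅`. It takes the form `q ^ n * R n = Q n` for all `n ≥ 1`, with
polynomials `R` and `Q`, which are positive at all `n ≥ 1` because the density of `X` is positive.
A nontrivial geometric sequence is not a quotient of polynomials, so `q = 1`, that is,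
`F_{⋃ A i ∪ C} * F_C ^ k = F_C * ∏ i, F_{A i ∪ C}` (`ae_subCdf_factorization`). Sending the
coordinates in `C` to infinity gives `F_{⋃ A i} = ∏ i, F_{A i}`, which is independence.
-/

open MeasureTheory ProbabilityTheory

namespace MaxStable

open Filter Asymptotics
open scoped Topology Polynomial

/-! ### Exponential polynomials -/

/-- If `G a r = G₀ + O(r)` for all `a` and, for every `n`, the signed sum
`(∑ a, σ a * G a r ^ n) / (2 r) ^ m` converges as `r → 0+`, then the limit is `G₀ ^ n` times a
polynomial in `n`. Writing `G a r = G₀ (1 + η a r)`, the binomial theorem turns the quotient into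
`G₀ ^ n * ∑ j ≤ n, n.choose j * c j r` with `c j r = (∑ a, σ a * η a r ^ j) / (2 r) ^ m`; each `c j`
converges, and the limit vanishes for `j > m`. -/
theorem exists_polynomial_tendsto {α : Type*} (s : Finset α) (σ : α → ℝ) (G : α → ℝ → ℝ)
    {G₀ : ℝ} (hG₀ : 0 < G₀) (m : ℕ)
    (hG : ∀ a ∈ s, (fun r => G a r - G₀) =O[𝓝[>] 0] fun r : ℝ => r)
    (hd : ∀ n : ℕ, ∃ d, Tendsto (fun r => (∑ a ∈ s, σ a * G a r ^ n) / (2 * r) ^ m)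
      (𝓝[>] 0) (𝓝 d)) :
    ∃ P : ℝ[X], ∀ n : ℕ, Tendsto (fun r => (∑ a ∈ s, σ a * G a r ^ n) / (2 * r) ^ m)
      (𝓝[>] 0) (𝓝 (G₀ ^ n * P.eval (n : ℝ))) := by
  set η : α → ℝ → ℝ := fun a r => G a r / G₀ - 1 with hη
  set c : ℕ → ℝ → ℝ := fun j r => (∑ a ∈ s, σ a * η a r ^ j) / (2 * r) ^ m with hc
  have hexp : ∀ n r, (∑ a ∈ s, σ a * G a r ^ n) / (2 * r) ^ m
      = G₀ ^ n * ∑ j ∈ Finset.range (n + 1), (n.choose j : ℝ) * c j r := by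
    intro n r
    have h1 : ∀ a, G a r ^ n
        = G₀ ^ n * ∑ j ∈ Finset.range (n + 1), (n.choose j : ℝ) * η a r ^ j := by
      intro a
      have : G a r = G₀ * (η a r + 1) := by simp only [hη]; field_simp; ring
      rw [this, mul_pow, add_pow]
      simp [mul_comm]
    simp only [hc, h1, Finset.mul_sum, Finset.sum_div]
    rw [Finset.sum_comm]
    refine Finset.sum_congr rfl fun j _ => Finset.sum_congr rfl fun a _ => ?_
    ring
  have hηO : ∀ a ∈ s, (fun r => η a r) =O[𝓝[>] 0] fun r : ℝ => r := by
    intro a ha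
    have : (fun r => η a r) = fun r => G₀⁻¹ * (G a r - G₀) := by
      funext r; simp only [hη]; field_simp
    rw [this]
    exact (hG a ha).const_mul_left _
  have hsmall : ∀ j, m < j → Tendsto (c j) (𝓝[>] 0) (𝓝 0) := by
    intro j hj
    have h1 : (fun r => ∑ a ∈ s, σ a * η a r ^ j) =O[𝓝[>] 0] fun r : ℝ => r ^ j :=
      IsBigO.fun_sum fun a ha => ((hηO a ha).pow j).const_mul_left _
    have h2 : (fun r : ℝ => r ^ j) =o[𝓝[>] 0] fun r : ℝ => (2 * r) ^ m := by
      have := (isLittleO_pow_pow (𝕜 := ℝ) hj).mono (nhdsWithin_le_nhds (s := Set.Ioi 0))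
      simp_rw [mul_pow]
      exact this.trans_isBigO
        ((isBigO_refl _ _).const_mul_right (pow_ne_zero _ two_ne_zero))
    exact (h1.trans_isLittleO h2).tendsto_div_nhds_zero
  have hconv : ∀ j, ∃ l, Tendsto (c j) (𝓝[>] 0) (𝓝 l) := by
    intro j
    induction j using Nat.strong_induction_on with
    | _ n ih =>
      obtain ⟨d, hd⟩ := hd n
      choose! l hl using ih
      refine ⟨(G₀ ^ n)⁻¹ * d - ∑ j ∈ Finset.range n, (n.choose j : ℝ) * l j, ?_⟩
      have h1 := (hd.const_mul (G₀ ^ n)⁻¹).sub (tendsto_finsetSum (Finset.range n) fun j hj =>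
        (hl j (Finset.mem_range.1 hj)).const_mul (n.choose j : ℝ))
      refine h1.congr fun r => ?_
      rw [hexp, Finset.sum_range_succ]
      have : G₀ ^ n ≠ 0 := by positivity
      field_simp
      simp
  choose l hl using hconv
  have hl0 : ∀ j, m < j → l j = 0 := fun j hj => tendsto_nhds_unique (hl j) (hsmall j hj)
  refine ⟨∑ j ∈ Finset.range (m + 1), Polynomial.C (l j / j.factorial) * descPochhammer ℝ j,
    fun n => ?_⟩
  simp_rw [hexp]
  refine Tendsto.const_mul _ ?_
  have h1 := tendsto_finsetSum (Finset.range (n + 1)) fun j _ =>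
    (hl j).const_mul (n.choose j : ℝ)
  convert h1 using 2
  have h2 : ∀ j, Polynomial.eval (n : ℝ) (Polynomial.C (l j / j.factorial) * descPochhammer ℝ j)
      = (n.choose j : ℝ) * l j := by
    intro j
    rw [Polynomial.eval_mul, Polynomial.eval_C, descPochhammer_eval_eq_descFactorial,
      Nat.descFactorial_eq_factorial_mul_choose]
    have : (j.factorial : ℝ) ≠ 0 := by positivity
    push_cast
    field_simp
  rw [Polynomial.eval_finsetSum]
  simp_rw [h2]
  -- both sums equal the sum over `j ≤ max m n`: the terms with `j > n` and with `j > m` vanish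
  rw [Finset.sum_subset (Finset.range_mono (Nat.succ_le_succ (le_max_left m n))),
    Finset.sum_subset (Finset.range_mono (Nat.succ_le_succ (le_max_right m n)))]
  · intro j _ hj
    rw [Nat.choose_eq_zero_of_lt (by simpa using hj)]; simp
  · intro j _ hj
    rw [hl0 j (by simpa using hj)]; simp

/-- A geometric sequence with ratio less than `1` is not a quotient of polynomials. -/
theorem one_le_of_pow_mul_eval_eq {q : ℝ} (hq : 0 < q) (R Q : ℝ[X])
    (hQ : ∀ n : ℕ, 1 ≤ n → 0 < Q.eval (n : ℝ))
    (h : ∀ n : ℕ, 1 ≤ n → q ^ n * R.eval (n : ℝ) = Q.eval (n : ℝ)) : 1 ≤ q := by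
  by_contra! hq1
  have hR : (fun n : ℕ => R.eval (n : ℝ)) =O[atTop] fun n : ℕ => (n : ℝ) ^ R.natDegree := by
    have : (fun x => R.eval x) =O[atTop] fun x : ℝ => (Polynomial.X ^ R.natDegree : ℝ[X]).eval x :=
      Polynomial.isBigO_atTop_of_degree_le _ _ (by simp [Polynomial.degree_le_natDegree])
    simpa [Function.comp_def] using this.comp_tendsto tendsto_natCast_atTop_atTop
  have h0 : Tendsto (fun n : ℕ => q ^ n * R.eval (n : ℝ)) atTop (𝓝 0) := by
    refine ((isBigO_refl (fun n : ℕ => q ^ n) atTop).mul hR).trans_tendsto ?_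
    simpa [mul_comm] using
      tendsto_pow_const_mul_const_pow_of_abs_lt_one R.natDegree (by rwa [abs_of_pos hq])
  have h1 : Tendsto (fun n : ℕ => Q.eval (n : ℝ)) atTop (𝓝 0) :=
    h0.congr' (by filter_upwards [eventually_ge_atTop 1] with n hn using h n hn)
  have hQ0 : Q ≠ 0 := by
    rintro rfl
    simpa using hQ 1 le_rfl
  rcases le_or_gt Q.degree 0 with hdeg | hdeg
  · rw [Polynomial.eq_C_of_degree_le_zero hdeg] at h1 hQ0
    simp only [Polynomial.eval_C, tendsto_const_nhds_iff] at h1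
    simp [h1] at hQ0
  · have h2 : Tendsto (fun n : ℕ => |Q.eval (n : ℝ)|) atTop atTop :=
      (Polynomial.abs_tendsto_atTop Q hdeg).comp tendsto_natCast_atTop_atTop
    exact not_tendsto_nhds_of_tendsto_atTop h2 _ h1.abs

theorem eq_one_of_pow_mul_eval_eq {q : ℝ} (hq : 0 < q) (R Q : ℝ[X])
    (hR : ∀ n : ℕ, 1 ≤ n → 0 < R.eval (n : ℝ)) (hQ : ∀ n : ℕ, 1 ≤ n → 0 < Q.eval (n : ℝ))
    (h : ∀ n : ℕ, 1 ≤ n → q ^ n * R.eval (n : ℝ) = Q.eval (n : ℝ)) : q = 1 := by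
  refine le_antisymm ?_ (one_le_of_pow_mul_eval_eq hq R Q hQ h)
  rw [← one_le_inv₀ hq]
  refine one_le_of_pow_mul_eval_eq (inv_pos.2 hq) Q R hR fun n hn => ?_
  rw [← h n hn, inv_pow, inv_mul_cancel_left₀ (pow_pos hq n).ne']

/-! ### Densities of a random variable on an event -/

section EventDensity

variable {Ω γ : Type*} [MeasurableSpace Ω] [MeasurableSpace γ]

/-- The density with respect to `ν` of the measure `B ↦ P(E ∩ {Z ∈ B})`, that is, of the law of `Z`
on the event `E`. -/
noncomputable def eventDensity (μ : Measure Ω) (Z : Ω → γ) (ν : Measure γ) (E : Set Ω) (y : γ) :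
    ℝ :=
  (((μ.restrict E).map Z).rnDeriv ν y).toReal

theorem map_restrict_absolutelyContinuous_map {μ : Measure Ω} {Z : Ω → γ} (hZ : Measurable Z)
    (E : Set Ω) : (μ.restrict E).map Z ≪ μ.map Z :=
  (Measure.restrict_le_self.absolutelyContinuous).map hZ

/-- The conditional probability of `E` given `Z`, as a function of the value of `Z`, is a
Radon-Nikodym derivative. -/
theorem condExp_indicator_ae_eq_rnDeriv {μ : Measure Ω} [IsFiniteMeasure μ] {Z : Ω → γ}
    (hZ : Measurable Z) {E : Set Ω} (hE : MeasurableSet E) :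
    (fun ω => (((μ.restrict E).map Z).rnDeriv (μ.map Z) (Z ω)).toReal)
      =ᵐ[μ] μ⟦E | MeasurableSpace.comap Z inferInstance⟧ := by
  refine (toReal_rnDeriv_map Measure.restrict_le_self.absolutelyContinuous hZ).trans
    (condExp_congr_ae ?_)
  filter_upwards [Measure.rnDeriv_restrict_self μ hE] with ω hω
  rw [hω]
  by_cases h : ω ∈ E <;> simp [h]

/-- Conditional independence of events given `Z`, written in terms of densities. Multiplying through
by powers of the density of `Z` avoids any division. -/
theorem eventDensity_iInter_mul {ι : Type*} [Fintype ι] {μ : Measure Ω} [IsFiniteMeasure μ]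
    {Z : Ω → γ} (hZ : Measurable Z) {ν κ : Measure γ} [SigmaFinite ν] (hκν : κ ≪ ν)
    (hκ : κ ≪ μ.map Z) {E : ι → Set Ω} (hE : ∀ i, MeasurableSet (E i))
    (hci : μ⟦⋂ i, E i | MeasurableSpace.comap Z inferInstance⟧ =ᵐ[μ]
      fun ω => ∏ i, (μ⟦E i | MeasurableSpace.comap Z inferInstance⟧) ω) :
    ∀ᵐ y ∂κ, eventDensity μ Z ν (⋂ i, E i) y * eventDensity μ Z ν Set.univ y ^ Fintype.card ι
      = eventDensity μ Z ν Set.univ y * ∏ i, eventDensity μ Z ν (E i) y := by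
  set r : Set Ω → γ → ℝ := fun F y => (((μ.restrict F).map Z).rnDeriv (μ.map Z) y).toReal with hr
  have hrm : ∀ F, Measurable (r F) := fun F => (Measure.measurable_rnDeriv _ _).ennreal_toReal
  have h1 : ∀ᵐ y ∂κ, r (⋂ i, E i) y = ∏ i, r (E i) y := by
    have h0 : ∀ᵐ y ∂μ.map Z, r (⋂ i, E i) y = ∏ i, r (E i) y := by
      rw [ae_map_iff hZ.aemeasurable
        (measurableSet_eq_fun (hrm _) (Finset.measurable_prod _ fun i _ => hrm _))]
      filter_upwards [hci, condExp_indicator_ae_eq_rnDeriv (μ := μ) hZ (MeasurableSet.iInter hE),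
        ae_all_iff.2 fun i => condExp_indicator_ae_eq_rnDeriv (μ := μ) hZ (hE i)] with ω a b c
      simp only [hr]
      rw [b, a]
      exact Finset.prod_congr rfl fun i _ => (c i).symm
    exact hκ.ae_le h0
  have h2 : ∀ F, ∀ᵐ y ∂κ, eventDensity μ Z ν F y = r F y * eventDensity μ Z ν Set.univ y := by
    intro F
    have := Measure.rnDeriv_mul_rnDeriv (κ := ν)
      (map_restrict_absolutelyContinuous_map (μ := μ) hZ F)
    filter_upwards [hκν.ae_le this] with y hy
    simp only [eventDensity, hr, Measure.restrict_univ]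
    rw [← hy, Pi.mul_apply, ENNReal.toReal_mul]
  filter_upwards [h1, h2 (⋂ i, E i), ae_all_iff.2 fun i => h2 (E i)] with y a b c
  rw [b, a, Finset.prod_congr rfl fun i _ => c i, Finset.prod_mul_distrib, Finset.prod_const,
    Finset.card_univ]
  ring

theorem eventDensity_pos {μ : Measure Ω} [IsFiniteMeasure μ] {Z : Ω → γ} {ν κ : Measure γ}
    [SigmaFinite ν] {E : Set Ω} (hκν : κ ≪ ν) (hκ : κ ≪ (μ.restrict E).map Z)
    (hν : (μ.restrict E).map Z ≪ ν) : ∀ᵐ y ∂κ, 0 < eventDensity μ Z ν E y := by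
  filter_upwards [hκ.ae_le (Measure.rnDeriv_pos hν),
    hκν.ae_le (Measure.rnDeriv_lt_top ((μ.restrict E).map Z) ν)] with y h1 h2
  exact ENNReal.toReal_pos h1.ne' h2.ne

/-- Besicovitch differentiation; balls for the sup norm are boxes. -/
theorem ae_tendsto_eventDensity {ι : Type*} [Fintype ι] (μ : Measure Ω) [IsFiniteMeasure μ]
    {Z : Ω → ι → ℝ} (hZ : Measurable Z) (E : Set Ω) :
    ∀ᵐ y, Tendsto (fun r => μ.real (E ∩ Z ⁻¹' Metric.closedBall y r) / (2 * r) ^ Fintype.card ι)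
      (𝓝[>] 0) (𝓝 (eventDensity μ Z volume E y)) := by
  filter_upwards [Besicovitch.ae_tendsto_rnDeriv ((μ.restrict E).map Z) volume,
    Measure.rnDeriv_lt_top ((μ.restrict E).map Z) volume] with y h1 h2
  refine ((ENNReal.tendsto_toReal h2.ne).comp h1).congr' ?_
  filter_upwards [self_mem_nhdsWithin] with r hr
  have hr : 0 < r := hr
  rw [Function.comp_apply, ENNReal.toReal_div, Real.volume_pi_closedBall y hr.le,
    ENNReal.toReal_ofReal (by positivity),
    Measure.map_apply hZ Metric.isClosed_closedBall.measurableSet,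
    Measure.restrict_apply (hZ Metric.isClosed_closedBall.measurableSet), Set.inter_comm,
    Measure.real]

end EventDensity

/-! ### Distribution functions of subvectors -/

variable {Ω I : Type*} {X : Ω → I → ℝ}

/-- The event `X_S ≤ x_S`; coordinates of `x` outside `S` are irrelevant. -/
def lowerEvent (X : Ω → I → ℝ) (S : Set I) (x : I → ℝ) : Set Ω := {ω | ∀ i ∈ S, X ω i ≤ x i}

theorem lowerEvent_union (S T : Set I) (x : I → ℝ) :
    lowerEvent X (S ∪ T) x = lowerEvent X S x ∩ lowerEvent X T x := by
  ext ω
  simp [lowerEvent, or_imp, forall_and]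

theorem lowerEvent_congr {S : Set I} {x y : I → ℝ} (h : ∀ i ∈ S, x i = y i) :
    lowerEvent X S x = lowerEvent X S y := by
  ext ω
  exact forall₂_congr fun i hi => by rw [h i hi]

theorem lowerEvent_iUnion {ι : Type*} (S : ι → Set I) (x : I → ℝ) :
    lowerEvent X (⋃ i, S i) x = ⋂ i, lowerEvent X (S i) x := by
  ext ω
  simp only [lowerEvent, Set.mem_ofPred_eq, Set.mem_iUnion, Set.mem_iInter]
  exact ⟨fun h i j hj => h j ⟨i, hj⟩, fun h j ⟨i, hj⟩ => h i j hj⟩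

theorem preimage_subvector_eq_lowerEvent {S A : Set I} (hSA : S ⊆ A)
    (x : I → ℝ) :
    subvector X A ⁻¹' {y | ∀ j : A, (j : I) ∈ S → y j ≤ x j} = lowerEvent X S x := by
  ext ω
  exact ⟨fun h j hj => h ⟨j, hSA hj⟩ hj, fun h j hj => h j hj⟩

variable [MeasurableSpace Ω] {μ : Measure Ω}

theorem measurable_subvector (hX : Measurable X) (C : Set I) : Measurable (subvector X C) :=
  measurable_pi_lambda _ fun i => measurable_pi_iff.1 hX i

/-- The distribution function `x ↦ P(X_S ≤ x_S)` of the subvector `X_S`, as a function of all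
of `x`. -/
noncomputable def subCdf (X : Ω → I → ℝ) (μ : Measure Ω) (S : Set I) (x : I → ℝ) : ℝ :=
  μ.real (lowerEvent X S x)

theorem subCdf_congr {S : Set I} {x y : I → ℝ} (h : ∀ i ∈ S, x i = y i) :
    subCdf X μ S x = subCdf X μ S y := by
  rw [subCdf, lowerEvent_congr h, subCdf]

theorem measurableSet_lowerEvent [Countable I] (hX : Measurable X) (S : Set I) (x : I → ℝ) :
    MeasurableSet (lowerEvent X S x) := by
  have : lowerEvent X S x = ⋂ i ∈ S, {ω | X ω i ≤ x i} := by ext; simp [lowerEvent]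
  rw [this]
  exact MeasurableSet.biInter (Set.to_countable S) fun i _ =>
    measurableSet_le (measurable_pi_iff.1 hX i) measurable_const

theorem measureReal_le_eq_zero [IsProbabilityMeasure μ] (hs : IsSimpleMaxStable X μ) (i : I)
    {z : ℝ} (hz : z ≤ 0) : μ.real {ω | X ω i ≤ z} = 0 := by
  refine le_antisymm ?_ measureReal_nonneg
  have h : Tendsto (fun x : ℝ => Real.exp (-(1 / x))) (𝓝[>] 0) (𝓝 0) := by
    simp_rw [one_div]
    exact Real.tendsto_exp_neg_atTop_nhds_zero.comp tendsto_inv_nhdsGT_zero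
  refine ge_of_tendsto h ?_
  filter_upwards [self_mem_nhdsWithin] with x hx
  rw [← hs.frechet i x hx]
  exact measureReal_mono fun ω (hω : X ω i ≤ z) => hω.trans (hz.trans (le_of_lt hx))

/-- Max-stability in terms of the distribution functions of all subvectors. -/
theorem exists_norming [Finite I] [IsProbabilityMeasure μ] (hX : Measurable X)
    (hs : IsSimpleMaxStable X μ) {n : ℕ} (hn : 1 ≤ n) :
    ∃ a b : I → ℝ, (∀ i, 0 < a i) ∧ ∀ (S : Set I) (x : I → ℝ),
      subCdf X μ S (fun i => (x i - b i) / a i) = subCdf X μ S x ^ n := by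
  obtain ⟨a, b, ha, hab⟩ := hs.isMaxStable n hn
  refine ⟨a, b, ha, fun S x => ?_⟩
  have : Nonempty (Fin n) := ⟨⟨0, hn⟩⟩
  have := Measure.isProbabilityMeasure_map (μ := μ) hX.aemeasurable
  set B : Set (I → ℝ) := {y | ∀ i ∈ S, y i ≤ x i} with hB
  have hBm : MeasurableSet B := by
    have : B = lowerEvent (id : (I → ℝ) → I → ℝ) S x := rfl
    rw [this]
    exact measurableSet_lowerEvent measurable_id S x
  have h1 : subCdf X μ S (fun i => (x i - b i) / a i)
      = (μ.map (fun ω i => a i * X ω i + b i)).real B := by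
    rw [map_measureReal_apply ?_ hBm]
    · refine congrArg μ.real (Set.ext fun ω => forall₂_congr fun i _ => ?_)
      rw [le_div_iff₀ (ha i), le_sub_iff_add_le, mul_comm]
    · exact measurable_pi_lambda _ fun i =>
        ((measurable_pi_iff.1 hX i).const_mul _).add_const _
  have h2 : (fun (y : Fin n → I → ℝ) i => ⨆ j, y j i) ⁻¹' B = Set.univ.pi fun _ => B := by
    ext y
    simp only [hB, Set.mem_preimage, Set.mem_ofPred_eq, Set.mem_pi, Set.mem_univ, true_imp_iff]
    refine ⟨fun h j i hi => (le_ciSup (Set.finite_range _).bddAbove j).trans (h i hi),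
      fun h i hi => ciSup_le fun j => h j i hi⟩
  rw [h1, hab, map_measureReal_apply ?_ hBm, h2, Measure.real, Measure.pi_pi, Finset.prod_const,
    ENNReal.toReal_pow, Finset.card_univ, Fintype.card_fin, Measure.map_apply hX hBm]
  · rfl
  · exact measurable_pi_lambda _ fun i => Measurable.iSup fun j => by fun_prop

/-- Standard Fréchet margins force the normalizing constants `a = n`, `b = 0`. -/
theorem subCdf_div_natCast [Finite I] [IsProbabilityMeasure μ] (hX : Measurable X)
    (hs : IsSimpleMaxStable X μ) {n : ℕ} (hn : 1 ≤ n) (S : Set I) (x : I → ℝ) :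
    subCdf X μ S (fun i => x i / n) = subCdf X μ S x ^ n := by
  obtain ⟨a, b, ha, h⟩ := exists_norming hX hs hn
  have hn0 : (0 : ℝ) < n := by exact_mod_cast hn
  have key : ∀ i, ∀ t : ℝ, 0 < t → a i * t = n * (t - b i) := by
    intro i t ht
    have h1 : ∀ z : I → ℝ, subCdf X μ {i} z = μ.real {ω | X ω i ≤ z i} := by
      intro z; simp [subCdf, lowerEvent]
    have h2 := h {i} fun _ => t
    rw [h1, h1, hs.frechet i t ht, ← Real.exp_nat_mul] at h2
    have hpos : 0 < (t - b i) / a i := by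
      by_contra! hle
      rw [measureReal_le_eq_zero hs i hle] at h2
      exact (Real.exp_pos _).ne h2
    have htb : 0 < t - b i := (div_pos_iff_of_pos_right (ha i)).1 hpos
    rw [hs.frechet i _ hpos, Real.exp_eq_exp] at h2
    have := ha i
    field_simp at h2
    linarith
  rw [← h S x]
  congr 1
  funext i
  have h1 := key i 1 one_pos
  have h2 := key i 2 two_pos
  have hb : b i = 0 := by
    have : (n : ℝ) * b i = 0 := by linarith
    exact (mul_eq_zero.1 this).resolve_left hn0.ne'
  have : a i = n := by rw [hb] at h1; linarith
  rw [hb, this, sub_zero]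

theorem measureReal_diff_le_abs [IsFiniteMeasure μ] {A B : Set Ω} (hB : MeasurableSet B)
    (h : A ⊆ B ∨ B ⊆ A) : μ.real (A \ B) ≤ |μ.real A - μ.real B| := by
  rcases h with h | h
  · simp [Set.sdiff_eq_empty.2 h]
  · rw [measureReal_sdiff h hB]
    exact le_abs_self _

theorem subCdf_sub_le [Fintype I] [IsFiniteMeasure μ] (hX : Measurable X) (S : Set I)
    (x y : I → ℝ) : subCdf X μ S x - subCdf X μ S y
      ≤ ∑ i, |μ.real {ω | X ω i ≤ x i} - μ.real {ω | X ω i ≤ y i}| := by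
  have hsub : lowerEvent X S x ⊆
      lowerEvent X S y ∪ ⋃ i, {ω | X ω i ≤ x i} \ {ω | X ω i ≤ y i} := by
    intro ω hω
    by_cases h : ω ∈ lowerEvent X S y
    · exact Or.inl h
    · simp only [lowerEvent, Set.mem_ofPred_eq, not_forall] at h
      obtain ⟨i, hi, h⟩ := h
      exact Or.inr (Set.mem_iUnion.2 ⟨i, hω i hi, h⟩)
  have h1 := (measureReal_mono (μ := μ) hsub).trans (measureReal_union_le _ _)
  have h2 : μ.real (⋃ i, {ω | X ω i ≤ x i} \ {ω | X ω i ≤ y i})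
      ≤ ∑ i, |μ.real {ω | X ω i ≤ x i} - μ.real {ω | X ω i ≤ y i}| := by
    refine (measureReal_iUnion_fintype_le _).trans (Finset.sum_le_sum fun i _ => ?_)
    refine measureReal_diff_le_abs
      (measurableSet_le (measurable_pi_iff.1 hX i) measurable_const) ?_
    rcases le_total (x i) (y i) with h | h
    · exact Or.inl fun ω (hω : X ω i ≤ x i) => hω.trans h
    · exact Or.inr fun ω (hω : X ω i ≤ y i) => hω.trans h
  simp only [subCdf]
  linarith

theorem abs_subCdf_sub_le [Fintype I] [IsFiniteMeasure μ] (hX : Measurable X) (S : Set I)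
    (x y : I → ℝ) : |subCdf X μ S x - subCdf X μ S y|
      ≤ ∑ i, |μ.real {ω | X ω i ≤ x i} - μ.real {ω | X ω i ≤ y i}| := by
  rw [abs_sub_le_iff]
  refine ⟨subCdf_sub_le hX S x y, ?_⟩
  simpa only [abs_sub_comm] using subCdf_sub_le (μ := μ) hX S y x

/-- The distribution functions are Lipschitz along rays at points of the orthant, because the
Fréchet margins are. -/
theorem subCdf_add_mul_sub_isBigO [Fintype I] [IsProbabilityMeasure μ] (hX : Measurable X)
    (hs : IsSimpleMaxStable X μ) (S : Set I) {x : I → ℝ} (hx : x ∈ orthant I) (e : I → ℝ) :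
    (fun r : ℝ => subCdf X μ S (fun i => x i + r * e i) - subCdf X μ S x) =O[𝓝[>] 0]
      fun r : ℝ => r := by
  have h1 : ∀ i, (fun r : ℝ => |μ.real {ω | X ω i ≤ x i + r * e i} - μ.real {ω | X ω i ≤ x i}|)
      =O[𝓝[>] 0] fun r : ℝ => r := by
    intro i
    have hxi := hx i
    have hd : DifferentiableAt ℝ (fun r : ℝ => Real.exp (-(1 / (x i + r * e i)))) 0 := by
      have : x i + 0 * e i ≠ 0 := by simpa using hxi.ne'
      fun_prop (disch := assumption)
    have h2 := hd.isBigO_sub.mono (nhdsWithin_le_nhds (s := Set.Ioi 0))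
    simp only [zero_mul, add_zero, sub_zero] at h2
    refine (h2.congr' ?_ EventuallyEq.rfl).abs_left
    have hc : Tendsto (fun r : ℝ => x i + r * e i) (𝓝[>] 0) (𝓝 (x i)) := by
      have : Continuous fun r : ℝ => x i + r * e i := by fun_prop
      simpa using (this.tendsto 0).mono_left nhdsWithin_le_nhds
    filter_upwards [hc.eventually (lt_mem_nhds hxi)] with r hr
    rw [hs.frechet i _ hr, hs.frechet i _ hxi]
  refine IsBigO.trans (IsBigO.of_bound 1 (Eventually.of_forall fun r => ?_))
    (IsBigO.fun_sum fun i (_ : i ∈ Finset.univ) => h1 i)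
  rw [Real.norm_eq_abs, Real.norm_eq_abs, one_mul]
  exact (abs_subCdf_sub_le hX S _ _).trans (le_abs_self _)

/-- Sending the coordinates in `C` to infinity removes them from the distribution function. -/
theorem tendsto_subCdf_union [Fintype I] [IsProbabilityMeasure μ] (hX : Measurable X)
    (hs : IsSimpleMaxStable X μ) (S C : Set I) (u : I → ℝ) (x : ℕ → I → ℝ)
    (hu : ∀ N, ∀ i ∈ S, x N i = u i) (hx : ∀ i ∈ C, Tendsto (fun N => x N i) atTop atTop) :
    Tendsto (fun N => subCdf X μ (S ∪ C) (x N)) atTop (𝓝 (subCdf X μ S u)) := by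
  have hlow : ∀ N, subCdf X μ S u - ∑ i ∈ C.toFinite.toFinset,
      (1 - μ.real {ω | X ω i ≤ x N i}) ≤ subCdf X μ (S ∪ C) (x N) := by
    intro N
    have hsub : lowerEvent X S u ⊆
        lowerEvent X (S ∪ C) (x N) ∪ ⋃ i ∈ C.toFinite.toFinset, {ω | X ω i ≤ x N i}ᶜ := by
      intro ω hω
      by_cases h : ω ∈ lowerEvent X C (x N)
      · rw [lowerEvent_union, lowerEvent_congr (hu N)]
        exact Or.inl ⟨hω, h⟩
      · simp only [lowerEvent, Set.mem_ofPred_eq, not_forall] at h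
        obtain ⟨i, hi, h⟩ := h
        exact Or.inr (Set.mem_iUnion₂.2 ⟨i, by simpa using hi, h⟩)
    have h1 := (measureReal_mono (μ := μ) hsub).trans (measureReal_union_le _ _)
    have h2 := measureReal_biUnion_finset_le (μ := μ) C.toFinite.toFinset
      fun i => {ω | X ω i ≤ x N i}ᶜ
    have h3 : ∀ i, μ.real {ω | X ω i ≤ x N i}ᶜ = 1 - μ.real {ω | X ω i ≤ x N i} := fun i =>
      probReal_compl_eq_one_sub
        (measurableSet_le (measurable_pi_iff.1 hX i) measurable_const)
    simp only [h3] at h2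
    simp only [subCdf]
    linarith
  have hup : ∀ N, subCdf X μ (S ∪ C) (x N) ≤ subCdf X μ S u := by
    intro N
    simp only [subCdf]
    rw [lowerEvent_union, lowerEvent_congr (hu N)]
    exact measureReal_mono Set.inter_subset_left
  refine tendsto_of_tendsto_of_tendsto_of_le_of_le ?_ tendsto_const_nhds hlow hup
  have h1 : ∀ i ∈ C.toFinite.toFinset,
      Tendsto (fun N => 1 - μ.real {ω | X ω i ≤ x N i}) atTop (𝓝 (1 - 1)) := by
    intro i hi
    have hi := hx i (by simpa using hi)
    refine Tendsto.const_sub _ ?_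
    have h0 : Tendsto (fun N => Real.exp (-(1 / x N i))) atTop (𝓝 1) := by
      have := (tendsto_inv_atTop_zero.comp hi).neg
      have := (Real.continuous_exp.tendsto _).comp this
      simpa [Function.comp_def] using this
    refine h0.congr' ?_
    filter_upwards [hi.eventually_gt_atTop 0] with N hN
    rw [hs.frechet i _ hN]
  simpa using (tendsto_finsetSum _ h1).const_sub (subCdf X μ S u)

/-! ### Probabilities of boxes -/

/-- Inclusion-exclusion for the probability of a half-open box. -/
theorem measureReal_inter_box [IsFiniteMeasure μ] [DecidableEq I] {E : Set Ω}
    (hE : MeasurableSet E) (c : Finset I) (U L : I → Set Ω) (hU : ∀ i, MeasurableSet (U i))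
    (hL : ∀ i, MeasurableSet (L i)) (hLU : ∀ i, L i ⊆ U i) :
    μ.real (E ∩ ⋂ i ∈ c, U i \ L i) = ∑ t ∈ c.powerset,
      (-1) ^ t.card * μ.real (E ∩ ((⋂ i ∈ c \ t, U i) ∩ ⋂ i ∈ t, L i)) := by
  have hb : ∀ (s : Finset I) (V : I → Set Ω) (ω : Ω),
      ∏ i ∈ s, (V i).indicator (1 : Ω → ℝ) ω = (⋂ i ∈ s, V i).indicator 1 ω := by
    intro s V ω
    classical
    simp only [Set.indicator_apply, Pi.one_apply, Finset.prod_ite_zero, Finset.prod_const_one,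
      Set.mem_iInter]
  have hm : ∀ t : Finset I,
      MeasurableSet (E ∩ ((⋂ i ∈ c \ t, U i) ∩ ⋂ i ∈ t, L i)) := fun t =>
    hE.inter ((Finset.measurableSet_biInter _ fun i _ => hU i).inter
      (Finset.measurableSet_biInter _ fun i _ => hL i))
  have hm' : MeasurableSet (E ∩ ⋂ i ∈ c, U i \ L i) :=
    hE.inter (Finset.measurableSet_biInter _ fun i _ => (hU i).diff (hL i))
  rw [← integral_indicator_one hm']
  simp_rw [← integral_indicator_one (μ := μ) (hm _), ← integral_const_mul]
  rw [← integral_finsetSum]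
  · congr 1
    funext ω
    have hd : ∀ i, (U i \ L i).indicator (1 : Ω → ℝ) ω
        = (U i).indicator 1 ω - (L i).indicator 1 ω := fun i =>
      congrFun (Set.indicator_sdiff (hLU i) (1 : Ω → ℝ)) ω
    simp only [Set.inter_indicator_one, Pi.mul_apply, ← hb, hd, Finset.prod_sub, Finset.mul_sum]
    refine Finset.sum_congr rfl fun t _ => ?_
    ring
  · exact fun t _ => ((integrable_const (1 : ℝ)).indicator (hm t)).const_mul _

/-- The sign vector of a corner of the box `∏ i ∈ c, (x i - r, x i + r]`: lower endpoints in the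
coordinates of `t`, upper endpoints in those of `c \ t`. -/
def cornerSign [DecidableEq I] (c t : Finset I) (i : I) : ℝ :=
  if i ∈ t then -1 else if i ∈ c then 1 else 0

theorem measureReal_lowerEvent_inter_box [Finite I] [IsFiniteMeasure μ] [DecidableEq I]
    (hX : Measurable X) {S : Set I} {c : Finset I} (hSc : Disjoint S c) (x : I → ℝ) {r : ℝ}
    (hr : 0 ≤ r) :
    μ.real (lowerEvent X S x ∩ {ω | ∀ i ∈ c, X ω i ∈ Set.Ioc (x i - r) (x i + r)})
      = ∑ t ∈ c.powerset, (-1) ^ t.card *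
          subCdf X μ (S ∪ c) (fun i => x i + r * cornerSign c t i) := by
  have hm : ∀ (y : I → ℝ) i, MeasurableSet {ω | X ω i ≤ y i} := fun y i =>
    measurableSet_le (measurable_pi_iff.1 hX i) measurable_const
  have h := measureReal_inter_box (μ := μ) (measurableSet_lowerEvent hX S x) c
    (fun i => {ω | X ω i ≤ x i + r}) (fun i => {ω | X ω i ≤ x i - r}) (hm _) (hm _)
    (fun i ω (hω : X ω i ≤ x i - r) => hω.trans (by linarith))
  convert h using 2
  · congr 1
    ext ω
    simp [and_comm]
  · rename_i t ht
    rw [Finset.mem_powerset] at ht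
    rw [subCdf, lowerEvent_union]
    congr 3
    · refine lowerEvent_congr fun i hi => ?_
      have hic : i ∉ c := fun hic => Set.disjoint_left.1 hSc hi hic
      have hit : i ∉ t := fun hit => hic (ht hit)
      simp [cornerSign, hic, hit]
    · ext ω
      simp only [lowerEvent, Set.mem_ofPred_eq, Set.mem_inter_iff, Set.mem_iInter,
        Finset.mem_sdiff, Finset.mem_coe]
      constructor
      · refine fun h => ⟨fun i hi => ?_, fun i hi => ?_⟩
        · simpa [cornerSign, hi.1, hi.2] using h i hi.1
        · simpa [cornerSign, hi, sub_eq_add_neg] using h i (ht hi)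
      · rintro ⟨h1, h2⟩ i hi
        by_cases hit : i ∈ t
        · simpa [cornerSign, hit, sub_eq_add_neg] using h2 i hit
        · simpa [cornerSign, hit, hi] using h1 i ⟨hi, hit⟩

/-! ### Consequences of the positive density -/

variable [Fintype I]

theorem measurableSet_orthant (J : Type*) [Countable J] : MeasurableSet (orthant J) := by
  have : orthant J = ⋂ i, {x | 0 < x i} := by ext; simp [orthant]
  rw [this]
  exact MeasurableSet.iInter fun i => measurableSet_lt measurable_const (measurable_pi_apply i)

theorem HasPositiveContinuousDensity.map_absolutelyContinuous
    (h : HasPositiveContinuousDensity X μ) : μ.map X ≪ volume := by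
  obtain ⟨f, -, -, h⟩ := h
  rw [h]
  exact (withDensity_absolutelyContinuous _ _).trans Measure.restrict_le_self.absolutelyContinuous

theorem HasPositiveContinuousDensity.absolutelyContinuous_map
    (h : HasPositiveContinuousDensity X μ) : volume.restrict (orthant I) ≪ μ.map X := by
  obtain ⟨f, hc, hpos, h⟩ := h
  rw [h]
  refine withDensity_absolutelyContinuous'
    (hc.aemeasurable (measurableSet_orthant I)).ennreal_ofReal ?_
  filter_upwards [ae_restrict_mem (measurableSet_orthant I)] with x hx
  simpa using hpos x hx

theorem HasPositiveContinuousDensity.ae_ne (h : HasPositiveContinuousDensity X μ)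
    (hX : Measurable X) (x : I → ℝ) : ∀ᵐ ω ∂μ, ∀ i, X ω i ≠ x i := by
  refine ae_all_iff.2 fun i => ?_
  have h1 : ∀ᵐ y ∂(μ.map X), y i ≠ x i :=
    h.map_absolutelyContinuous.ae_le
      (Measure.ae_eval_ne (fun _ : I => (volume : Measure ℝ)) i (x i))
  exact ae_of_ae_map hX.aemeasurable h1

theorem quasiMeasurePreserving_restrict (C : Set I) [Fintype C] :
    Measure.QuasiMeasurePreserving (C.domRestrict : (I → ℝ) → C → ℝ) volume volume := by
  classical
  obtain rfl : ‹Fintype C› = Subtype.fintype (· ∈ C) := Subsingleton.elim _ _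
  exact Measure.quasiMeasurePreserving_fst.comp
    (volume_preserving_piEquivPiSubtypeProd (fun _ : I => ℝ) (· ∈ C)).quasiMeasurePreserving

theorem HasPositiveContinuousDensity.map_subvector_absolutelyContinuous
    (h : HasPositiveContinuousDensity X μ) (hX : Measurable X) (C : Set I) [Fintype C]
    (E : Set Ω) : (μ.restrict E).map (subvector X C) ≪ volume := by
  refine (map_restrict_absolutelyContinuous_map (measurable_subvector hX C) E).trans ?_
  have : subvector X C = (C.domRestrict : (I → ℝ) → C → ℝ) ∘ X := rfl
  have hq := quasiMeasurePreserving_restrict C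
  rw [this, ← Measure.map_map hq.measurable hX]
  exact (h.map_absolutelyContinuous.map hq.measurable).trans hq.absolutelyContinuous

/-- The law of `X_C` on the event `X_S ≤ u_S` charges every non-null subset of the orthant. -/
theorem HasPositiveContinuousDensity.absolutelyContinuous_map_subvector
    (h : HasPositiveContinuousDensity X μ) (hX : Measurable X) {S C : Set I} [Fintype C]
    (hSC : Disjoint S C) {u : I → ℝ} (hu : u ∈ orthant I) :
    volume.restrict (orthant C) ≪ (μ.restrict (lowerEvent X S u)).map (subvector X C) := by
  classical
  obtain rfl : ‹Fintype C› = Subtype.fintype (· ∈ C) := Subsingleton.elim _ _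
  refine Measure.AbsolutelyContinuous.mk fun B hB h0 => ?_
  have hZ := measurable_subvector hX C
  have hL : MeasurableSet (lowerEvent (id : (I → ℝ) → I → ℝ) S u) :=
    measurableSet_lowerEvent measurable_id S u
  have hq := quasiMeasurePreserving_restrict C
  rw [Measure.map_apply hZ hB, Measure.restrict_apply (hZ hB)] at h0
  have h1 : μ.map X (C.domRestrict ⁻¹' B ∩ lowerEvent (id : (I → ℝ) → I → ℝ) S u) = 0 := by
    rw [Measure.map_apply hX ((hq.measurable hB).inter hL)]
    exact h0
  have h2 := h.absolutelyContinuous_map h1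
  rw [Measure.restrict_apply ((hq.measurable hB).inter hL)] at h2
  rw [Measure.restrict_apply hB]
  set K : Set ({i // i ∉ C} → ℝ) := Set.univ.pi fun i => Set.Ioc 0 (u i) with hK
  have hmp := volume_preserving_piEquivPiSubtypeProd (fun _ : I => ℝ) (· ∈ C)
  have h3 : volume ((B ∩ orthant C) ×ˢ K) = 0 := by
    refine (hmp.measure_preimage_equiv _).symm.trans (measure_mono_null ?_ h2)
    rintro y ⟨⟨hyB, hyC⟩, hyK⟩
    have hyK' : ∀ i, i ∉ C → 0 < y i ∧ y i ≤ u i := fun i hi => hyK ⟨i, hi⟩ (Set.mem_univ _)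
    refine ⟨⟨hyB, fun i hi => (hyK' i (Set.disjoint_left.1 hSC hi)).2⟩, fun i => ?_⟩
    by_cases hi : i ∈ C
    · exact hyC ⟨i, hi⟩
    · exact (hyK' i hi).1
  rw [Measure.volume_eq_prod, Measure.prod_prod, mul_eq_zero] at h3
  refine h3.resolve_right ?_
  rw [hK, Real.volume_pi_Ioc, Finset.prod_eq_zero_iff]
  rintro ⟨i, -, hi⟩
  have := hu i
  simp only [sub_zero, ENNReal.ofReal_eq_zero] at hi
  linarith

theorem HasPositiveContinuousDensity.subCdf_pos [IsFiniteMeasure μ]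
    (h : HasPositiveContinuousDensity X μ) (hX : Measurable X) (S : Set I) {x : I → ℝ}
    (hx : x ∈ orthant I) : 0 < subCdf X μ S x := by
  refine ENNReal.toReal_pos (fun h0 => ?_) (measure_ne_top _ _)
  have hB : MeasurableSet (Set.univ.pi fun i => Set.Ioc 0 (x i)) :=
    MeasurableSet.univ_pi fun i => measurableSet_Ioc
  have h1 : μ.map X (Set.univ.pi fun i => Set.Ioc 0 (x i)) = 0 := by
    rw [Measure.map_apply hX hB]
    have hsub : X ⁻¹' (Set.univ.pi fun i => Set.Ioc 0 (x i)) ⊆ lowerEvent X S x :=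
      fun ω hω i _ => (hω i (Set.mem_univ i)).2
    exact measure_mono_null hsub h0
  have h2 := h.absolutelyContinuous_map h1
  rw [Measure.restrict_apply hB, Set.inter_eq_left.2 fun y hy i => (hy i (Set.mem_univ i)).1,
    Real.volume_pi_Ioc, Finset.prod_eq_zero_iff] at h2
  obtain ⟨i, -, hi⟩ := h2
  have := hx i
  simp only [sub_zero, ENNReal.ofReal_eq_zero] at hi
  linarith

/-! ### Factorization of the distribution function -/

/-- At points of the orthant the densities of `X_C` on the events `X_S ≤ x_S / n`, evaluated at
`x_C / n`, are exponential in `n` up to a polynomial factor. -/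
theorem exists_polynomial_eventDensity [IsProbabilityMeasure μ] (hX : Measurable X)
    (hs : IsSimpleMaxStable X μ) (hd : HasPositiveContinuousDensity X μ) {S C : Set I} [Fintype C]
    (hSC : Disjoint S C) {x : I → ℝ} (hx : x ∈ orthant I) (δ : ℕ → ℝ)
    (hδ : ∀ n : ℕ, 1 ≤ n → Tendsto (fun r => μ.real (lowerEvent X S (fun i => x i / n) ∩
      subvector X C ⁻¹' Metric.closedBall (fun i : C => x i / n) r) / (2 * r) ^ Fintype.card C)
      (𝓝[>] 0) (𝓝 (δ n))) :
    ∃ P : ℝ[X], ∀ n : ℕ, 1 ≤ n → δ n = subCdf X μ (S ∪ C) x ^ n * P.eval (n : ℝ) := by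
  classical
  set c : Finset I := C.toFinset with hc
  have hcC : (c : Set I) = C := Set.coe_toFinset C
  have hcard : c.card = Fintype.card C := Set.toFinset_card C
  set G : Finset I → ℝ → ℝ := fun t r =>
    subCdf X μ (S ∪ c) (fun i => x i + r * cornerSign c t i) with hG
  set D : ℕ → ℝ → ℝ := fun n r =>
    (∑ t ∈ c.powerset, (-1) ^ t.card * G t r ^ n) / (2 * r) ^ c.card with hD
  have hbox : ∀ n : ℕ, 1 ≤ n → ∀ r : ℝ, 0 < r →
      μ.real (lowerEvent X S (fun i => x i / n) ∩
        subvector X C ⁻¹' Metric.closedBall (fun i : C => x i / n) (r / n))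
      = ∑ t ∈ c.powerset, (-1) ^ t.card * G t r ^ n := by
    intro n hn r hr
    have hrn : 0 ≤ r / n := by positivity
    simp_rw [hG, ← subCdf_div_natCast hX hs hn]
    have h1 := measureReal_lowerEvent_inter_box (μ := μ) hX (S := S) (c := c) (hcC ▸ hSC)
      (fun i => x i / n) hrn
    have h2 : ∀ t i, (x i + r * cornerSign c t i) / n = x i / n + r / n * cornerSign c t i := by
      intro t i; ring
    simp_rw [h2]
    rw [← h1]
    refine measureReal_congr ?_
    -- the closed ball and the half-open box differ by a null set
    filter_upwards [hd.ae_ne hX fun i => x i / n - r / n] with ω hω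
    refine propext (and_congr_right fun _ => ?_)
    change subvector X C ω ∈ Metric.closedBall _ _ ↔ _
    rw [closedBall_pi _ hrn]
    simp only [Set.mem_pi, Set.mem_univ, true_imp_iff, Subtype.forall, Real.closedBall_eq_Icc,
      subvector]
    have hmem : ∀ i, i ∈ c ↔ i ∈ C := fun i => Set.mem_toFinset
    refine forall_congr' fun i => ?_
    rw [hmem]
    exact imp_congr_right fun _ => ⟨fun h => ⟨lt_of_le_of_ne h.1 (hω i).symm, h.2⟩,
      fun h => ⟨h.1.le, h.2⟩⟩
  have hlim : ∀ n : ℕ, 1 ≤ n → Tendsto (D n) (𝓝[>] 0) (𝓝 (δ n / (n : ℝ) ^ c.card)) := by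
    intro n hn
    have hn0 : (0 : ℝ) < n := by exact_mod_cast hn
    have hr : Tendsto (fun r : ℝ => r / n) (𝓝[>] 0) (𝓝[>] 0) := by
      refine tendsto_nhdsWithin_of_tendsto_nhds_of_eventually_within _ ?_ ?_
      · have : Continuous fun r : ℝ => r / n := by fun_prop
        simpa using (this.tendsto 0).mono_left nhdsWithin_le_nhds
      · filter_upwards [self_mem_nhdsWithin] with r hr using div_pos hr hn0
    refine (((hδ n hn).comp hr).div_const ((n : ℝ) ^ c.card)).congr' ?_
    filter_upwards [self_mem_nhdsWithin] with r hr
    have hr : 0 < r := hr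
    simp only [Function.comp_apply, hD]
    rw [hbox n hn r hr, hcard, div_div, ← mul_pow]
    congr 2
    field_simp
  -- for `n = 0` the numerator is `∑ t ⊆ c, (-1) ^ #t`, which is `0` unless `c` is empty
  have hlim0 : ∃ d, Tendsto (D 0) (𝓝[>] 0) (𝓝 d) := by
    by_cases hce : c = ∅
    · refine ⟨1, ?_⟩
      have : D 0 = fun _ => 1 := by
        funext r; simp only [hD, pow_zero, hce]; simp
      rw [this]
      exact tendsto_const_nhds
    · refine ⟨0, ?_⟩
      have h0 : ∑ t ∈ c.powerset, (-1 : ℝ) ^ t.card = 0 := by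
        have := Finset.sum_powerset_neg_one_pow_card_of_nonempty
          (Finset.nonempty_iff_ne_empty.2 hce)
        exact_mod_cast this
      have : D 0 = fun _ => 0 := by
        funext r; simp only [hD, pow_zero, mul_one, h0, zero_div]
      rw [this]
      exact tendsto_const_nhds
  obtain ⟨P, hP⟩ := exists_polynomial_tendsto c.powerset (fun t => (-1) ^ t.card) G
    (hd.subCdf_pos hX (S ∪ c) hx) c.card
    (fun t _ => subCdf_add_mul_sub_isBigO hX hs (S ∪ c) hx (cornerSign c t))
    (fun n => by
      rcases Nat.eq_zero_or_pos n with rfl | hn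
      · exact hlim0
      · exact ⟨_, hlim n hn⟩)
  refine ⟨Polynomial.X ^ c.card * P, fun n hn => ?_⟩
  have hn0 : (n : ℝ) ≠ 0 := by positivity
  have h := tendsto_nhds_unique (hlim n hn) (hP n)
  rw [div_eq_iff (pow_ne_zero _ hn0)] at h
  rw [h, hcC, Polynomial.eval_mul, Polynomial.eval_pow, Polynomial.eval_X]
  ring

/-- If a property holds almost everywhere in the orthant for each `n ≥ 1`, then for almost all `y`
it holds at all the points `y / n` simultaneously. -/
theorem ae_forall_div_natCast {J : Type*} [Fintype J] {Q : ℕ → (J → ℝ) → Prop}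
    (h : ∀ n : ℕ, 1 ≤ n → ∀ᵐ y ∂(volume.restrict (orthant J)), Q n y) :
    ∀ᵐ y ∂(volume.restrict (orthant J)), ∀ n : ℕ, 1 ≤ n → Q n fun i => y i / n := by
  rw [ae_restrict_iff' (measurableSet_orthant J)]
  have h1 : ∀ n : ℕ, ∀ᵐ y : J → ℝ, 1 ≤ n → y ∈ orthant J → Q n fun i => y i / n := by
    intro n
    by_cases hn : 1 ≤ n
    · have hn0 : (0 : ℝ) < n := by exact_mod_cast hn
      have h2 := (ae_restrict_iff' (measurableSet_orthant J)).1 (h n hn)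
      have h3 := (Measure.quasiMeasurePreserving_smul (volume : Measure (J → ℝ))
        (inv_ne_zero hn0.ne')).ae h2
      filter_upwards [h3] with y hy _ hyo
      have h4 : (n : ℝ)⁻¹ • y = fun i => y i / n := by
        funext i; simp [div_eq_inv_mul]
      rw [h4] at hy
      exact hy fun i => div_pos (hyo i) hn0
    · exact Eventually.of_forall fun _ h => absurd h hn
  filter_upwards [ae_all_iff.2 h1] with y hy hyo n hn using hy n hn hyo

/-- The key rigidity statement: conditional independence given `X_C` forces the distribution
functions to factorize as they would under independence given `X_C ≤ y`. The identity between the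
densities at `(u, y) / n` reads `q ^ n * R n = Q n` with polynomials `R`, `Q` that are positive at
all `n ≥ 1`, whence `q = 1`. Here `x` is the vector with coordinates `y` on `C` and `u` elsewhere,
and `∅ ∪ C` is kept unsimplified to treat all the index sets `T ∪ C` alike. -/
theorem ae_subCdf_factorization [IsProbabilityMeasure μ] (hX : Measurable X)
    (hs : IsSimpleMaxStable X μ) (hd : HasPositiveContinuousDensity X μ) {ι : Type*} [Fintype ι]
    {A S : ι → Set I} {C : Set I} [Fintype C] (hAC : ∀ i, Disjoint (A i) C)
    (hSA : ∀ i, S i ⊆ A i)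
    (hci : CondIndepGiven (fun i => subvector X (A i)) (subvector X C) μ)
    {u : I → ℝ} (hu : u ∈ orthant I) :
    ∀ᵐ y ∂(volume.restrict (orthant C)), ∀ x : I → ℝ, x ∈ orthant I → (∀ i ∉ C, x i = u i) →
      (∀ i : C, x i = y i) →
      subCdf X μ ((⋃ i, S i) ∪ C) x * subCdf X μ (∅ ∪ C) x ^ Fintype.card ι
        = subCdf X μ (∅ ∪ C) x * ∏ i, subCdf X μ (S i ∪ C) x := by
  have hSC : ∀ i, Disjoint (S i) C := fun i => (hAC i).mono_left (hSA i)
  have hUC : Disjoint (⋃ i, S i) C := Set.disjoint_iUnion_left.2 hSC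
  have h0C : Disjoint (∅ : Set I) C := Set.empty_disjoint C
  have hZ := measurable_subvector hX C
  have hun : ∀ n : ℕ, 1 ≤ n → (fun i => u i / n) ∈ orthant I := fun n hn i =>
    div_pos (hu i) (by exact_mod_cast hn)
  have hrestr : (volume.restrict (orthant C) : Measure (C → ℝ)) ≪ volume :=
    Measure.restrict_le_self.absolutelyContinuous
  set d : ℕ → Set I → (C → ℝ) → ℝ := fun n T =>
    eventDensity μ (subvector X C) volume (lowerEvent X T fun i => u i / n) with hdd
  have hlim : ∀ T : Set I, ∀ n : ℕ, 1 ≤ n → ∀ᵐ y ∂(volume.restrict (orthant C)),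
      Tendsto (fun r => μ.real (lowerEvent X T (fun i => u i / n) ∩
        subvector X C ⁻¹' Metric.closedBall y r) / (2 * r) ^ Fintype.card C)
        (𝓝[>] 0) (𝓝 (d n T y)) := fun T n _ =>
    hrestr.ae_le (ae_tendsto_eventDensity μ hZ _)
  have hpos : ∀ T : Set I, Disjoint T C → ∀ n : ℕ, 1 ≤ n →
      ∀ᵐ y ∂(volume.restrict (orthant C)), 0 < d n T y := fun T hT n hn =>
    eventDensity_pos hrestr (hd.absolutelyContinuous_map_subvector hX hT (hun n hn))
      (hd.map_subvector_absolutelyContinuous hX C _)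
  have hprod : ∀ n : ℕ, 1 ≤ n → ∀ᵐ y ∂(volume.restrict (orthant C)),
      d n (⋃ i, S i) y * d n ∅ y ^ Fintype.card ι = d n ∅ y * ∏ i, d n (S i) y := by
    intro n hn
    have h0 : lowerEvent X ∅ (fun i => u i / (n : ℝ)) = Set.univ := by
      ext ω; simp [lowerEvent]
    have hκ : volume.restrict (orthant C) ≪ μ.map (subvector X C) := by
      have := hd.absolutelyContinuous_map_subvector hX h0C (hun n hn)
      rwa [h0, Measure.restrict_univ] at this
    have h1 := hci (fun i => {y | ∀ j : A i, (j : I) ∈ S i → y j ≤ u j / n}) fun i => by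
      have : {y : A i → ℝ | ∀ j : A i, (j : I) ∈ S i → y j ≤ u j / n}
          = lowerEvent (id : (A i → ℝ) → A i → ℝ) {j | (j : I) ∈ S i} fun j => u j / n := rfl
      rw [this]
      exact measurableSet_lowerEvent measurable_id _ _
    simp only [fun i => preimage_subvector_eq_lowerEvent (X := X) (hSA i) fun j => u j / (n : ℝ)]
      at h1
    have h2 := eventDensity_iInter_mul hZ hrestr hκ
      (fun i => measurableSet_lowerEvent hX (S i) fun j => u j / (n : ℝ)) h1
    simpa only [hdd, lowerEvent_iUnion, h0] using h2
  filter_upwards [ae_forall_div_natCast (hlim (⋃ i, S i)), ae_forall_div_natCast (hlim ∅),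
    ae_all_iff.2 fun i => ae_forall_div_natCast (hlim (S i)),
    ae_forall_div_natCast (hpos _ hUC), ae_forall_div_natCast (hpos _ h0C),
    ae_all_iff.2 fun i => ae_forall_div_natCast (hpos _ (hSC i)),
    ae_forall_div_natCast hprod] with y lU l0 lS pU p0 pS hy x hx hxu hxy
  set F : Set I → ℝ := fun T => subCdf X μ (T ∪ C) x with hF
  have hFpos : ∀ T, 0 < F T := fun T => hd.subCdf_pos hX _ hx
  have hpoly : ∀ T : Set I, Disjoint T C → (∀ n : ℕ, 1 ≤ n →
      Tendsto (fun r => μ.real (lowerEvent X T (fun i => u i / n) ∩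
        subvector X C ⁻¹' Metric.closedBall (fun i => y i / n) r) / (2 * r) ^ Fintype.card C)
        (𝓝[>] 0) (𝓝 (d n T fun i => y i / n))) →
      ∃ P : ℝ[X], ∀ n : ℕ, 1 ≤ n → d n T (fun i => y i / n) = F T ^ n * P.eval (n : ℝ) := by
    intro T hT hl
    refine exists_polynomial_eventDensity hX hs hd hT hx _ fun n hn => ?_
    have h1 : lowerEvent X T (fun i => x i / (n : ℝ)) = lowerEvent X T fun i => u i / n :=
      lowerEvent_congr fun i hi => by rw [hxu i (Set.disjoint_left.1 hT hi)]
    simp only [h1, hxy]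
    exact hl n hn
  obtain ⟨PU, hPU⟩ := hpoly _ hUC lU
  obtain ⟨P0, hP0⟩ := hpoly _ h0C l0
  choose PS hPS using fun i => hpoly _ (hSC i) (lS i)
  have hpolypos : ∀ {a b : ℝ}, 0 < a → 0 < a * b → 0 < b := fun ha h =>
    (mul_pos_iff_of_pos_left ha).1 h
  have posU : ∀ n : ℕ, 1 ≤ n → 0 < PU.eval (n : ℝ) := fun n hn =>
    hpolypos (pow_pos (hFpos _) n) (hPU n hn ▸ pU n hn)
  have pos0 : ∀ n : ℕ, 1 ≤ n → 0 < P0.eval (n : ℝ) := fun n hn =>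
    hpolypos (pow_pos (hFpos _) n) (hP0 n hn ▸ p0 n hn)
  have posS : ∀ i, ∀ n : ℕ, 1 ≤ n → 0 < (PS i).eval (n : ℝ) := fun i n hn =>
    hpolypos (pow_pos (hFpos _) n) (hPS i n hn ▸ pS i n hn)
  have hden : 0 < F ∅ * ∏ i, F (S i) := mul_pos (hFpos _) (Finset.prod_pos fun i _ => hFpos _)
  have hq : F (⋃ i, S i) * F ∅ ^ Fintype.card ι / (F ∅ * ∏ i, F (S i)) = 1 := by
    refine eq_one_of_pow_mul_eval_eq
      (div_pos (mul_pos (hFpos _) (pow_pos (hFpos _) _)) hden)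
      (PU * P0 ^ Fintype.card ι) (P0 * ∏ i, PS i) (fun n hn => ?_) (fun n hn => ?_)
      fun n hn => ?_
    · rw [Polynomial.eval_mul, Polynomial.eval_pow]
      exact mul_pos (posU n hn) (pow_pos (pos0 n hn) _)
    · rw [Polynomial.eval_mul, Polynomial.eval_prod]
      exact mul_pos (pos0 n hn) (Finset.prod_pos fun i _ => posS i n hn)
    · have h := hy n hn
      rw [hPU n hn, hP0 n hn, Finset.prod_congr rfl fun i _ => hPS i n hn,
        Finset.prod_mul_distrib, Finset.prod_pow] at h
      rw [Polynomial.eval_mul, Polynomial.eval_pow, Polynomial.eval_mul, Polynomial.eval_prod,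
        div_pow, div_mul_eq_mul_div, div_eq_iff (pow_pos hden n).ne', mul_pow, mul_pow, ← pow_mul,
        mul_comm (Fintype.card ι), pow_mul]
      rw [mul_pow, ← pow_mul, mul_comm n, pow_mul, ← pow_mul, mul_comm _ n, pow_mul] at h
      linear_combination h
  rwa [div_eq_one_iff_eq hden.ne'] at hq

/-- Factorization of the distribution function without the conditioning variables: the limit
`y → ∞` of `ae_subCdf_factorization`. Taking `S i` to be either `A i` or empty gives independence of
every subfamily. -/
theorem subCdf_iUnion_eq_prod [IsProbabilityMeasure μ] (hX : Measurable X)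
    (hs : IsSimpleMaxStable X μ) (hd : HasPositiveContinuousDensity X μ) {ι : Type*} [Fintype ι]
    {A S : ι → Set I} {C : Set I} (hAC : ∀ i, Disjoint (A i) C) (hSA : ∀ i, S i ⊆ A i)
    (hci : CondIndepGiven (fun i => subvector X (A i)) (subvector X C) μ) (u : I → ℝ) :
    subCdf X μ (⋃ i, S i) u = ∏ i, subCdf X μ (S i) u := by
  classical
  -- a non-positive threshold makes both sides vanish
  by_cases hneg : ∃ i, ∃ j ∈ S i, u j ≤ 0
  · obtain ⟨i, j, hj, huj⟩ := hneg
    have hz : ∀ T : Set I, j ∈ T → subCdf X μ T u = 0 := fun T hT =>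
      have hsub : lowerEvent X T u ⊆ {ω | X ω j ≤ u j} := fun ω hω => hω j hT
      le_antisymm ((measureReal_mono hsub).trans (measureReal_le_eq_zero hs j huj).le)
        measureReal_nonneg
    rw [hz _ (Set.mem_iUnion.2 ⟨i, hj⟩), Finset.prod_eq_zero (Finset.mem_univ i) (hz _ hj)]
  push Not at hneg
  -- coordinates outside `⋃ i, S i` are irrelevant and may be taken positive
  wlog hu : u ∈ orthant I generalizing u
  · have h := this (fun j => if j ∈ ⋃ i, S i then u j else 1)
      (fun i j hj => by rw [if_pos (Set.mem_iUnion.2 ⟨i, hj⟩)]; exact hneg i j hj)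
      (fun j => by
        dsimp only
        split_ifs with hj
        · obtain ⟨i, hi⟩ := Set.mem_iUnion.1 hj
          exact hneg i j hi
        · exact one_pos)
    have hc : ∀ T ⊆ ⋃ i, S i, subCdf X μ T (fun j => if j ∈ ⋃ i, S i then u j else 1)
        = subCdf X μ T u := fun T hT => subCdf_congr fun j hj => if_pos (hT hj)
    rwa [hc _ le_rfl, Finset.prod_congr rfl fun i _ => hc _ (Set.subset_iUnion S i)] at h
  have hfact := ae_subCdf_factorization hX hs hd hAC hSA hci hu
  have hy : ∀ N : ℕ, ∃ x : I → ℝ, (∀ i ∉ C, x i = u i) ∧ (∀ i ∈ C, (N : ℝ) ≤ x i) ∧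
      subCdf X μ ((⋃ i, S i) ∪ C) x * subCdf X μ (∅ ∪ C) x ^ Fintype.card ι
        = subCdf X μ (∅ ∪ C) x * ∏ i, subCdf X μ (S i ∪ C) x := by
    intro N
    set B : Set (C → ℝ) := Set.univ.pi fun _ => Set.Ioc (N : ℝ) (N + 1) with hB
    have hBO : B ⊆ orthant C := fun y hy i =>
      (Nat.cast_nonneg N).trans_lt (hy i (Set.mem_univ i)).1
    have hvol : volume B ≠ 0 := by
      rw [hB, Real.volume_pi_Ioc]; simp
    obtain ⟨y, hyB, hy⟩ := Measure.exists_mem_of_measure_ne_zero_of_ae hvol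
      (ae_restrict_of_ae_restrict_of_subset hBO hfact)
    have hxC : ∀ i (hi : i ∈ C), (if h : i ∈ C then y ⟨i, h⟩ else u i) = y ⟨i, hi⟩ :=
      fun i hi => dif_pos hi
    have hxC' : ∀ i ∉ C, (if h : i ∈ C then y ⟨i, h⟩ else u i) = u i := fun i hi => dif_neg hi
    refine ⟨fun i => if h : i ∈ C then y ⟨i, h⟩ else u i, hxC', fun i hi => ?_,
      hy _ (fun i => ?_) hxC' fun i => hxC i i.2⟩
    · exact (hyB ⟨i, hi⟩ (Set.mem_univ _)).1.le.trans_eq (hxC i hi).symm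
    · by_cases hi : i ∈ C
      · exact (hBO hyB ⟨i, hi⟩).trans_eq (hxC i hi).symm
      · exact (hu i).trans_eq (hxC' i hi).symm
  choose x hxu hxN hx using hy
  have hlim : ∀ T : Set I, Disjoint T C →
      Tendsto (fun N => subCdf X μ (T ∪ C) (x N)) atTop (𝓝 (subCdf X μ T u)) := fun T hT =>
    tendsto_subCdf_union hX hs T C u x
      (fun N i hi => hxu N i (Set.disjoint_left.1 hT hi))
      (fun i hi => tendsto_atTop_mono (fun N => hxN N i hi) tendsto_natCast_atTop_atTop)
  have hSC : ∀ i, Disjoint (S i) C := fun i => (hAC i).mono_left (hSA i)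
  have h0 : subCdf X μ ∅ u = 1 := by
    have : lowerEvent X ∅ u = Set.univ := by ext ω; simp [lowerEvent]
    rw [subCdf, this, probReal_univ]
  have hl0 := h0 ▸ hlim ∅ (Set.empty_disjoint C)
  have h1 := (hlim _ (Set.disjoint_iUnion_left.2 hSC)).mul (hl0.pow (Fintype.card ι))
  have h2 := hl0.mul (tendsto_finsetProd Finset.univ fun i _ => hlim _ (hSC i))
  simpa using tendsto_nhds_unique (h1.congr hx) h2

/-! ### Generating the σ-algebras of the subvectors -/

/-- Lower orthants generate the σ-algebra of a subvector. -/
theorem comap_subvector_eq_generateFrom {Ω I : Type*} [Finite I] (X : Ω → I → ℝ) (A : Set I) :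
    MeasurableSpace.comap (subvector X A) inferInstance
      = MeasurableSpace.generateFrom (Set.range (lowerEvent X A)) := by
  have hspan : IsCountablySpanning (Set.range (Set.Iic : ℝ → Set ℝ)) := by
    refine ⟨fun n : ℕ => Set.Iic (n : ℝ), fun n => ⟨n, rfl⟩, ?_⟩
    refine Set.eq_univ_of_forall fun x => ?_
    obtain ⟨n, hn⟩ := exists_nat_ge x
    exact Set.mem_iUnion.2 ⟨n, hn⟩
  have h1 : (inferInstance : MeasurableSpace (A → ℝ)) = MeasurableSpace.generateFrom
      (Set.univ.pi '' Set.univ.pi fun _ : A => Set.range (Set.Iic : ℝ → Set ℝ)) := by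
    rw [← generateFrom_pi_eq fun _ => hspan, ← borel_eq_generateFrom_Iic,
      ← BorelSpace.measurable_eq]
  rw [h1, MeasurableSpace.comap_generateFrom]
  congr 1
  ext E
  constructor
  · rintro ⟨_, ⟨s, hs, rfl⟩, rfl⟩
    choose v hv using fun j => hs j (Set.mem_univ j)
    classical
    refine ⟨fun j => if hj : j ∈ A then v ⟨j, hj⟩ else 0, ?_⟩
    ext ω
    simp only [lowerEvent, Set.mem_ofPred_eq, Set.mem_preimage, Set.mem_pi, Set.mem_univ,
      true_imp_iff, Subtype.forall]
    refine forall₂_congr fun j hj => ?_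
    rw [dif_pos hj, ← hv ⟨j, hj⟩]
    rfl
  · rintro ⟨x, rfl⟩
    refine ⟨Set.univ.pi fun j => Set.Iic (x j), ⟨_, fun j _ => ⟨x j, rfl⟩, rfl⟩, ?_⟩
    ext ω
    simp [lowerEvent, subvector, Pi.le_def]

theorem isPiSystem_range_lowerEvent {Ω I : Type*} (X : Ω → I → ℝ) (A : Set I) :
    IsPiSystem (Set.range (lowerEvent X A)) := by
  rintro _ ⟨x, rfl⟩ _ ⟨y, rfl⟩ -
  refine ⟨fun i => min (x i) (y i), ?_⟩
  ext ω
  simp [lowerEvent, forall_and]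

end MaxStable

theorem corollary1 {Ω I : Type*} [Fintype I] [MeasurableSpace Ω]
    (μ : Measure Ω) [IsProbabilityMeasure μ]
    (X : Ω → I → ℝ) (hX : Measurable X)
    (hsimple : MaxStable.IsSimpleMaxStable X μ)
    (hdens : MaxStable.HasPositiveContinuousDensity X μ)
    (k : ℕ) (A : Fin k → Set I)
    (hne : ∀ i, (A i).Nonempty) (hdisj : Pairwise fun i j => Disjoint (A i) (A j))
    (hci : MaxStable.CondIndepGiven (fun i => MaxStable.subvector X (A i))
      (MaxStable.subvector X (⋃ i, A i)ᶜ) μ) :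
    iIndepFun (fun i => MaxStable.subvector X (A i)) μ := by
  classical
  rw [iIndepFun_iff_iIndep]
  refine iIndepSets.iIndep (fun i => (MaxStable.measurable_subvector hX (A i)).comap_le)
    (fun i => Set.range (MaxStable.lowerEvent X (A i)))
    (fun i => MaxStable.isPiSystem_range_lowerEvent X (A i))
    (fun i => MaxStable.comap_subvector_eq_generateFrom X (A i)) ?_
  rw [iIndepSets_iff]
  intro s E hE
  choose! v hv using hE
  -- the sets `A i` being disjoint, the thresholds `v i` are restrictions of a single vector `u`
  have hu : ∃ u : I → ℝ, ∀ i, ∀ j ∈ A i, u j = v i j := by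
    refine ⟨fun j => if h : ∃ i, j ∈ A i then v h.choose j else 0, fun i j hj => ?_⟩
    have h : ∃ i, j ∈ A i := ⟨i, hj⟩
    have : h.choose = i := by
      by_contra hne
      exact Set.disjoint_left.1 (hdisj hne) h.choose_spec hj
    dsimp only
    rw [dif_pos h, this]
  obtain ⟨u, hu⟩ := hu
  -- indices outside `s` impose no constraint
  set S : Fin k → Set I := fun i => if i ∈ s then A i else ∅ with hS
  have hSE : ∀ i ∈ s, MaxStable.lowerEvent X (S i) u = E i := fun i hi => by
    rw [← hv i hi, hS]
    simp only [if_pos hi]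
    exact MaxStable.lowerEvent_congr (hu i)
  have hSuniv : ∀ i ∉ s, MaxStable.lowerEvent X (S i) u = Set.univ := fun i hi => by
    ext ω; simp [hS, hi, MaxStable.lowerEvent]
  have h := MaxStable.subCdf_iUnion_eq_prod hX hsimple hdens (A := A) (S := S)
    (fun i => Set.disjoint_compl_right_iff_subset.2 (Set.subset_iUnion A i))
    (fun i => by simp only [hS]; split_ifs <;> simp) hci u
  have hinter : MaxStable.lowerEvent X (⋃ i, S i) u = ⋂ i ∈ s, E i := by
    rw [MaxStable.lowerEvent_iUnion]
    ext ω
    simp only [Set.mem_iInter]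
    refine forall_congr' fun i => ?_
    by_cases hi : i ∈ s
    · simp [hi, hSE i hi]
    · simp [hi, hSuniv i hi]
  have hprod : ∏ i, MaxStable.subCdf X μ (S i) u = ∏ i ∈ s, μ.real (E i) := by
    rw [← Finset.prod_subset (Finset.subset_univ s)]
    · exact Finset.prod_congr rfl fun i hi => by rw [MaxStable.subCdf, hSE i hi]
    · intro i _ hi
      rw [MaxStable.subCdf, hSuniv i hi, probReal_univ]
  rw [hprod, MaxStable.subCdf, hinter] at h
  rw [← ENNReal.toReal_eq_toReal_iff' (measure_ne_top _ _)
    (ENNReal.prod_ne_top fun i _ => measure_ne_top _ _), ENNReal.toReal_prod]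
  exact h
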